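/- All rings are associative with identity, not necessarily commutative. For a ring $S$ let $\mathrm{nil}(S)$ be its set of nilpotent elements; $S$ is reduced if $\mathrm{nil}(S)=\{0\}$, and $2$-primal if $\mathrm{nil}(S)$ equals the prime radical of $S$ (the intersection of all prime two-sided ideals). Let $Z_N(S)^*$ be the set of non-zero $a\in S$ such that $ab\in\mathrm{nil}(S)$ for some non-zero $b\in S$. The nilpotent graph $\Gamma_N(S)$ has vertex set $Z_N(S)^*$, distinct vertices $a,b$ being adjacent iff $ab\in\mathrm{nil}(S)$. The zero-divisor graph $\Gamma(S)$ has as vertices the non-zero left or right zero divisors of $S$, distinct vertices $a,b$ being adjacent iff $ab=0$ or $ba=0$. The diameter of a graph is the supremum in $\mathbb{N}\cup\{\infty\}$ of the distances between its vertices (and $0$ if there are no vertices). Let $n\ge 1$ and let $A=\sigma(R)\langle x_1,\dots,x_n\rangle$ be a skew PBW extension of $R$, that is: $R$ is a subring of $A$ with the same identity; $x_1,\dots,x_n\in A$ and the monomials $x_1^{\alpha_1}\cdots x_n^{\alpha_n}$, $\alpha\in\mathbb{N}^n$, form a basis of $A$ as a left $R$-module; for each $i$ and each non-zero $r\in R$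 there is a non-zero $c\in R$ with $x_ir-cx_i\in R$; and for all $i,j$ there is a non-zero $d\in R$ with $x_jx_i-dx_ix_j\in R+Rx_1+\cdots+Rx_n$. Let $\sigma_i,\delta_i:R\to R$ be the maps determined by $x_ir=\sigma_i(r)x_i+\delta_i(r)$ for all $r\in R$, and write $\sigma^\alpha=\sigma_1^{\alpha_1}\circ\cdots\circ\sigma_n^{\alpha_n}$ and $\delta^\beta=\delta_1^{\beta_1}\circ\cdots\circ\delta_n^{\beta_n}$. Suppose that $R$ is $(\Sigma,\Delta)$-compatible, i.e. for all $a,b\in R$ and $\alpha,\beta\in\mathbb{N}^n$ one has $a\sigma^\alpha(b)=0\iff ab=0$, and $ab=0$ implies $a\delta^\beta(b)=0$; and suppose that $R$ is $2$-primal. Then: 1. $\mathrm{diam}(\Gamma_N(A))\le 3$, and if $Z_N(A)^*\neq\emptyset$, i.e. if $\Gamma_N(A)$ has a vertex, then $2\le\mathrm{diam}(\Gamma_N(A))$. 2. If $R$ is not reduced, then $\mathrm{diam}(\Gamma_N(A))=2$. 3. If $R$ is reduced, then $\mathrm{diam}(\Gamma_N(A))=\mathrm{diam}(\Gamma(A))\le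 3$. -/

import Mathlib

/-!
If `R` is reduced, so is `A`: reordering the variables in a word changes its leading coefficient
by a unit, so by compatibility the product of the leading coefficients of `f` and `g` in the
degree-lexicographic order can only be cancelled in `f * g` if it is already zero. Nilpotent then
means zero. Vertices `a` and `b` with `a * c = 0` and `b * d = 0` are joined by the path
`a, c, d, b` if `c * d = 0` and by `a, c * d, b` otherwise. If all vertices were adjacent or equal,
every element of `A` would be idempotent, but `x i ^ 2 ≠ x i`.

If `R` is 2-primal but not reduced, it is not semiprime, so `r R r = 0` for some `r ≠ 0`.
Compatibility extends this to `r A r = 0`, so `r * f` is nilpotent for all `f`. Hence every non-zero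
element is a vertex joined to `r`, while `1` and `x i` are not adjacent.
-/

namespace NilpotentGraphPaper

/-! ### Two-primal rings -/

/-- A proper two-sided ideal `P` of a (not necessarily commutative) ring is prime if
`I J ⊆ P` implies `I ⊆ P` or `J ⊆ P` for all two-sided ideals `I`, `J`. -/
def IsPrimeIdeal {R : Type*} [Ring R] (P : TwoSidedIdeal R) : Prop :=
  P ≠ ⊤ ∧ ∀ I J : TwoSidedIdeal R, (∀ a ∈ I, ∀ b ∈ J, a * b ∈ P) → I ≤ P ∨ J ≤ P

/-- The prime radical `P(R)`: the intersection of all prime ideals. -/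
def primeRadical (R : Type*) [Ring R] : Set R :=
  {a | ∀ P : TwoSidedIdeal R, IsPrimeIdeal P → a ∈ P}

/-- `R` is 2-primal if `P(R) = nil(R)`. -/
def IsTwoPrimal (R : Type*) [Ring R] : Prop :=
  primeRadical R = {a : R | IsNilpotent a}

/-! ### Nilpotent graph and zero-divisor graph -/

/-- `Z_N(R)^*`: the nonzero `a` such that `a * b` is nilpotent for some nonzero `b`. -/
def nilZeroDivisors (R : Type*) [Ring R] : Set R :=
  {a | a ≠ 0 ∧ ∃ b : R, b ≠ 0 ∧ IsNilpotent (a * b)}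

theorem isNilpotent_mul_swap {R : Type*} [Ring R] {a b : R} (h : IsNilpotent (a * b)) :
    IsNilpotent (b * a) := by
  obtain ⟨k, hk⟩ := h
  have key : ∀ m : ℕ, (b * a) ^ (m + 1) = b * (a * b) ^ m * a := by
    intro m
    induction m with
    | zero => simp
    | succ m ih => rw [pow_succ, ih, pow_succ (a * b)]; simp only [mul_assoc]
  exact ⟨k + 1, by rw [key, hk]; simp⟩

/-- The nilpotent graph `Γ_N(R)`: its vertices are the elements of `Z_N(R)^*`, and distinct
vertices `a`, `b` are adjacent iff `a * b` is nilpotent. -/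
def nilpotentGraph (R : Type*) [Ring R] : SimpleGraph (nilZeroDivisors R) where
  Adj a b := a ≠ b ∧ IsNilpotent ((a : R) * (b : R))
  symm := ⟨fun _ _ h => ⟨h.1.symm, isNilpotent_mul_swap h.2⟩⟩
  loopless := ⟨fun _ h => h.1 rfl⟩

/-- `Z(R)^*`: the nonzero left or right zero divisors of `R`. -/
def zeroDivisors (R : Type*) [Ring R] : Set R :=
  {a | a ≠ 0 ∧ ∃ b : R, b ≠ 0 ∧ (a * b = 0 ∨ b * a = 0)}

/-- The zero-divisor graph `Γ(R)`: its vertices are the elements of `Z(R)^*`, and distinct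
vertices `a`, `b` are adjacent iff `a * b = 0` or `b * a = 0`. -/
def zeroDivisorGraph (R : Type*) [Ring R] : SimpleGraph (zeroDivisors R) where
  Adj a b := a ≠ b ∧ ((a : R) * (b : R) = 0 ∨ (b : R) * (a : R) = 0)
  symm := ⟨fun _ _ h => ⟨h.1.symm, h.2.symm⟩⟩
  loopless := ⟨fun _ h => h.1 rfl⟩

/-! ### Skew PBW extensions -/

/-- The standard monomial `x_1 ^ α_1 * ⋯ * x_n ^ α_n`, in this order. -/
def stdMonomial {A : Type*} [Ring A] {n : ℕ} (x : Fin n → A) (α : Fin n → ℕ) : A :=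
  (List.ofFn fun i => x i ^ α i).prod

/-- `A` is a skew PBW extension `σ(R)⟨x_1, …, x_n⟩` of its subring `R`. -/
structure IsSkewPBWExtension {A : Type*} [Ring A] (R : Subring A) {n : ℕ} (x : Fin n → A) :
    Prop where
  /-- The standard monomials are linearly independent in the left `R`-module `A`. -/
  linearIndependent : LinearIndependent R (stdMonomial x)
  /-- The standard monomials span the left `R`-module `A`. -/
  span_eq_top : Submodule.span R (Set.range (stdMonomial x)) = ⊤
  /-- For `r ≠ 0` in `R` there is `c ≠ 0` in `R` with `x_i r - c x_i ∈ R`. -/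
  exists_coeff : ∀ (i : Fin n) (r : R), r ≠ 0 →
    ∃ c : R, c ≠ 0 ∧ x i * (r : A) - (c : A) * x i ∈ R
  /-- There is `d ≠ 0` in `R` with `x_j x_i - d x_i x_j ∈ R + R x_1 + ⋯ + R x_n`. -/
  exists_comm : ∀ i j : Fin n, ∃ d : R, d ≠ 0 ∧ ∃ (r₀ : R) (r : Fin n → R),
    x j * x i - (d : A) * (x i * x j) = (r₀ : A) + ∑ k, (r k : A) * x k

theorem stdMonomial_zero {A : Type*} [Ring A] {n : ℕ} (x : Fin n → A) :
    stdMonomial x 0 = 1 := by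
  simp [stdMonomial]

theorem stdMonomial_single {A : Type*} [Ring A] {n : ℕ} (x : Fin n → A) (i : Fin n) :
    stdMonomial x (Pi.single i 1) = x i := by
  induction n with
  | zero => exact i.elim0
  | succ n ih =>
    unfold stdMonomial
    rw [List.ofFn_succ, List.prod_cons]
    refine Fin.cases ?_ (fun j => ?_) i
    · simp
    · have h := ih (fun k => x k.succ) j
      unfold stdMonomial at h
      have h2 : ∀ k : Fin n, (Pi.single j.succ 1 : Fin (n + 1) → ℕ) k.succ
          = (Pi.single j 1 : Fin n → ℕ) k := by
        intro k
        simp [Pi.single_apply]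
      simp [h2, h]

namespace IsSkewPBWExtension

variable {A : Type*} [Ring A] {R : Subring A} {n : ℕ} {x : Fin n → A}

/-- The left `R`-basis of `A` formed by the standard monomials. -/
noncomputable def basis (h : IsSkewPBWExtension R x) : Module.Basis (Fin n → ℕ) R A :=
  Module.Basis.mk h.linearIndependent h.span_eq_top.ge

/-- `σ_i(r)`: the coefficient of `x_i` in `x_i r`. -/
noncomputable def sigma (h : IsSkewPBWExtension R x) (i : Fin n) (r : R) : R :=
  h.basis.repr (x i * (r : A)) (Pi.single i 1)

/-- `δ_i(r)`: the constant coefficient of `x_i r`. -/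
noncomputable def delta (h : IsSkewPBWExtension R x) (i : Fin n) (r : R) : R :=
  h.basis.repr (x i * (r : A)) 0

/-- `σ_i` and `δ_i` are determined by the relation `x_i r = σ_i(r) x_i + δ_i(r)`. -/
theorem eq_sigma_delta (h : IsSkewPBWExtension R x) {i : Fin n} {r s t : R}
    (hst : x i * (r : A) = (s : A) * x i + (t : A)) : h.sigma i r = s ∧ h.delta i r = t := by
  have h1 : x i * (r : A) = s • h.basis (Pi.single i 1) + t • h.basis 0 := by
    simp only [basis, Module.Basis.mk_apply, stdMonomial_zero, stdMonomial_single,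
      Subring.smul_def, smul_eq_mul, mul_one]
    exact hst
  have hne : (Pi.single i 1 : Fin n → ℕ) ≠ 0 := by simp
  unfold sigma delta
  rw [h1]
  constructor <;> simp [hne, hne.symm]

/-- The relation `x_i r = σ_i(r) x_i + δ_i(r)`. -/
theorem mul_eq_sigma_delta (h : IsSkewPBWExtension R x) (i : Fin n) (r : R) :
    x i * (r : A) = (h.sigma i r : A) * x i + (h.delta i r : A) := by
  have key : ∃ s t : R, x i * (r : A) = (s : A) * x i + (t : A) := by
    by_cases hr : r = 0
    · exact ⟨0, 0, by simp [hr]⟩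
    · obtain ⟨c, -, hc⟩ := h.exists_coeff i r hr
      exact ⟨c, ⟨_, hc⟩, by simp⟩
  obtain ⟨s, t, hst⟩ := key
  obtain ⟨h1, h2⟩ := h.eq_sigma_delta hst
  rw [h1, h2, hst]

end IsSkewPBWExtension

/-! ### Compatibility -/

/-- The composition `f_1 ^ α_1 ∘ ⋯ ∘ f_n ^ α_n` of iterates of self-maps. -/
def iterComp {R : Type*} {n : ℕ} (f : Fin n → R → R) (α : Fin n → ℕ) : R → R :=
  (List.ofFn fun i => (f i)^[α i]).foldr (fun g k => g ∘ k) id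

/-- `(Σ, Δ)`-compatibility of a ring with respect to families `σ`, `δ` of self-maps. -/
def IsCompatible {R : Type*} [Ring R] {n : ℕ} (σ δ : Fin n → R → R) : Prop :=
  (∀ (a b : R) (α : Fin n → ℕ), a * iterComp σ α b = 0 ↔ a * b = 0) ∧
  (∀ (a b : R) (β : Fin n → ℕ), a * b = 0 → a * iterComp δ β b = 0)

end NilpotentGraphPaper

namespace NilpotentGraphPaper

/-! ### Semiprime rings -/

section Semiprime

variable {S : Type*} [Ring S]

/-- A semiprime ring: `a S a = 0` forces `a = 0`. -/
def IsSemiprime (S : Type*) [Ring S] : Prop :=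
  ∀ a : S, (∀ s, a * s * a = 0) → a = 0

/-- An m-system: the noncommutative substitute for a multiplicative set. A two-sided ideal is
prime iff its complement is a non-empty m-system. -/
def IsMSystem (M : Set S) : Prop :=
  ∀ a ∈ M, ∀ b ∈ M, ∃ s, a * s * b ∈ M

theorem exists_mem_of_mem_sSup_of_isChain {c : Set (TwoSidedIdeal S)} (hne : c.Nonempty)
    (hc : IsChain (· ≤ ·) c) {a : S} (ha : a ∈ sSup c) : ∃ I ∈ c, a ∈ I := by
  obtain ⟨I₀, hI₀⟩ := hne
  let U : TwoSidedIdeal S := .mk' {a | ∃ I ∈ c, a ∈ I} ⟨I₀, hI₀, I₀.zero_mem⟩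
    (by
      rintro a b ⟨I, hI, ha⟩ ⟨J, hJ, hb⟩
      obtain ⟨K, hK, hIK, hJK⟩ := hc.directedOn I hI J hJ
      exact ⟨K, hK, K.add_mem (hIK ha) (hJK hb)⟩)
    (fun ⟨I, hI, ha⟩ => ⟨I, hI, I.neg_mem ha⟩)
    (fun ⟨I, hI, ha⟩ => ⟨I, hI, I.mul_mem_left _ _ ha⟩)
    (fun ⟨I, hI, ha⟩ => ⟨I, hI, I.mul_mem_right _ _ ha⟩)
  have mem_U {b : S} : b ∈ U ↔ ∃ I ∈ c, b ∈ I := TwoSidedIdeal.mem_mk' ..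
  have hU : sSup c ≤ U := sSup_le fun I hI b hb => mem_U.2 ⟨I, hI, hb⟩
  exact mem_U.1 (hU ha)

theorem IsMSystem.exists_isPrimeIdeal {M : Set S} (hM : IsMSystem M) (hne : M.Nonempty)
    {I : TwoSidedIdeal S} (hI : ∀ a ∈ M, a ∉ I) :
    ∃ P, IsPrimeIdeal P ∧ I ≤ P ∧ ∀ a ∈ M, a ∉ P := by
  obtain ⟨P, hIP, hP, hmax⟩ := zorn_le_nonempty₀ {J : TwoSidedIdeal S | ∀ a ∈ M, a ∉ J}
    (fun c hc hchain J hJ => ⟨sSup c, fun a ha haS =>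
      have ⟨K, hK, haK⟩ := exists_mem_of_mem_sSup_of_isChain ⟨J, hJ⟩ hchain haS
      hc hK a ha haK, fun _ => le_sSup⟩) I hI
  refine ⟨P, ⟨?_, fun J K hJK => ?_⟩, hIP, hP⟩
  · rintro rfl
    exact hP _ hne.some_mem trivial
  have meets (J : TwoSidedIdeal S) (hJ : ¬ J ≤ P) : ∃ a ∈ M, a ∈ J ⊔ P := by
    by_contra! h
    exact hJ (le_sup_left.trans (hmax h le_sup_right))
  by_contra! h
  obtain ⟨a, haM, ha⟩ := meets J h.1
  obtain ⟨b, hbM, hb⟩ := meets K h.2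
  obtain ⟨s, hs⟩ := hM a haM b hbM
  obtain ⟨j, hj, p, hp, rfl⟩ := TwoSidedIdeal.mem_sup.1 ha
  obtain ⟨k, hk, q, hq, rfl⟩ := TwoSidedIdeal.mem_sup.1 hb
  refine hP _ hs ?_
  have expand : (j + p) * s * (k + q) = j * s * k + (j * s * q + p * (s * (k + q))) := by
    noncomm_ring
  rw [expand]
  exact P.add_mem (hJK _ (J.mul_mem_right _ _ hj) _ hk)
    (P.add_mem (P.mul_mem_left _ _ hq) (P.mul_mem_right _ _ hp))

theorem IsSemiprime.exists_isMSystem (hS : IsSemiprime S) {a : S} (ha : a ≠ 0) :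
    ∃ M : Set S, IsMSystem M ∧ a ∈ M ∧ 0 ∉ M := by
  -- Later terms of a sequence `u (k + 1) = u k * s * u k` are left and right multiples of
  -- earlier ones, so its range is an m-system.
  have step (u : {u : S // u ≠ 0}) : ∃ s, u.1 * s * u.1 ≠ 0 := by
    by_contra! h
    exact u.2 (hS _ h)
  choose t ht using step
  let u : ℕ → {u : S // u ≠ 0} := fun k => (fun v => ⟨_, ht v⟩)^[k] ⟨a, ha⟩
  have u_succ (k : ℕ) : (u (k + 1)).1 = (u k).1 * t (u k) * (u k).1 := by
    simp only [u, Function.iterate_succ_apply']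
  have factor {k l : ℕ} (hkl : k ≤ l) :
      (∃ s, (u l).1 = (u k).1 * s) ∧ ∃ s, (u l).1 = s * (u k).1 := by
    induction l, hkl using Nat.le_induction with
    | base => exact ⟨⟨1, (mul_one _).symm⟩, ⟨1, (one_mul _).symm⟩⟩
    | succ l _ ih =>
      obtain ⟨⟨s, hs⟩, ⟨s', hs'⟩⟩ := ih
      refine ⟨⟨s * (t (u l) * (u l).1), ?_⟩, ⟨(u l).1 * t (u l) * s', ?_⟩⟩
      · rw [u_succ, ← mul_assoc, ← hs, mul_assoc]
      · rw [u_succ, mul_assoc _ s', ← hs']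
  refine ⟨Set.range fun k => (u k).1, ?_, ⟨0, rfl⟩, fun ⟨k, hk⟩ => (u k).2 hk⟩
  rintro _ ⟨k, rfl⟩ _ ⟨l, rfl⟩
  obtain ⟨s, hs⟩ := (factor (le_max_left k l)).1
  obtain ⟨s', hs'⟩ := (factor (le_max_right k l)).2
  refine ⟨s * t (u (max k l)) * s', max k l + 1, ?_⟩
  calc (u (max k l + 1)).1 = (u (max k l)).1 * t (u (max k l)) * (u (max k l)).1 := u_succ _
    _ = (u k).1 * s * t (u (max k l)) * (s' * (u l).1) := by rw [← hs, ← hs']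
    _ = (u k).1 * (s * t (u (max k l)) * s') * (u l).1 := by simp only [mul_assoc]

theorem IsSemiprime.eq_zero_of_mem_primeRadical (hS : IsSemiprime S) {a : S}
    (ha : a ∈ primeRadical S) : a = 0 := by
  by_contra ha0
  obtain ⟨M, hM, haM, h0M⟩ := hS.exists_isMSystem ha0
  obtain ⟨P, hP, -, hPM⟩ := hM.exists_isPrimeIdeal ⟨a, haM⟩ (I := ⊥)
    fun b hb hb0 => h0M ((TwoSidedIdeal.mem_bot S).1 hb0 ▸ hb)
  exact hPM a haM (ha P hP)

theorem IsTwoPrimal.isReduced_of_isSemiprime (h : IsTwoPrimal S) (hS : IsSemiprime S) :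
    IsReduced S :=
  ⟨fun _ ha => hS.eq_zero_of_mem_primeRadical (h.ge ha)⟩

end Semiprime

/-! ### Reduced rings -/

section Reduced

variable {S : Type*} [Ring S]

theorem isReduced_of_mul_self_eq_zero (h : ∀ a : S, a * a = 0 → a = 0) : IsReduced S :=
  (isReduced_iff_pow_one_lt 2 one_lt_two).2 fun a ha => h a (by rwa [← sq])

variable [IsReduced S]

theorem eq_zero_of_mul_self_eq_zero {a : S} (h : a * a = 0) : a = 0 :=
  IsReduced.eq_zero a ⟨2, by rw [sq, h]⟩

theorem mul_eq_zero_swap {a b : S} (h : a * b = 0) : b * a = 0 :=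
  eq_zero_of_mul_self_eq_zero (by rw [mul_assoc, ← mul_assoc a, h, zero_mul, mul_zero])

theorem mul_mul_eq_zero_of_mul_eq_zero {a b : S} (h : a * b = 0) (c : S) : a * c * b = 0 :=
  mul_eq_zero_swap (by rw [← mul_assoc, mul_eq_zero_swap h, zero_mul])

instance isDedekindFiniteMonoid_of_isReduced : IsDedekindFiniteMonoid S where
  mul_eq_one_symm {a b} hab := by
    have h : (1 - b * a) * b = 0 := by rw [sub_mul, one_mul, mul_assoc, hab, mul_one, sub_self]
    have h' : (1 - b * a) * a * b = 0 := mul_mul_eq_zero_of_mul_eq_zero h a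
    rw [mul_assoc, hab, mul_one, sub_eq_zero] at h'
    exact h'.symm

end Reduced

/-! ### Diameters of nilpotent graphs -/

section Diameter

variable {V : Type*} {G : SimpleGraph V}

theorem adj_or_eq_of_ediam_lt_two (h : G.ediam < 2) (u v : V) : G.Adj u v ∨ u = v := by
  have hlt : G.edist u v < 1 + 1 := by
    rw [one_add_one_eq_two]
    exact SimpleGraph.edist_le_ediam.trans_lt h
  exact SimpleGraph.edist_le_one_iff_adj_or_eq.1 ((ENat.lt_add_one_iff ENat.one_ne_top).1 hlt)

theorem ediam_congr {α : Type*} {s t : Set α} {G : SimpleGraph s} {H : SimpleGraph t}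
    (hst : s = t)
    (h : ∀ a b (ha : a ∈ s) (hb : b ∈ s),
      G.Adj ⟨a, ha⟩ ⟨b, hb⟩ ↔ H.Adj ⟨a, hst ▸ ha⟩ ⟨b, hst ▸ hb⟩) :
    G.ediam = H.ediam := by
  subst hst
  congr 1
  ext a b
  exact h a b a.2 b.2

end Diameter

section NilpotentGraph

variable {S : Type*} [Ring S]

theorem edist_nilpotentGraph_le_one {a b : nilZeroDivisors S} (h : IsNilpotent (a * b : S)) :
    (nilpotentGraph S).edist a b ≤ 1 := by
  rw [SimpleGraph.edist_le_one_iff_adj_or_eq, or_iff_not_imp_right]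
  exact fun hab => ⟨hab, h⟩

theorem edist_nilpotentGraph_le_two {a b c : nilZeroDivisors S} (hab : IsNilpotent (a * b : S))
    (hbc : IsNilpotent (b * c : S)) : (nilpotentGraph S).edist a c ≤ 2 :=
  calc (nilpotentGraph S).edist a c
      ≤ (nilpotentGraph S).edist a b + (nilpotentGraph S).edist b c := SimpleGraph.edist_triangle
    _ ≤ 1 + 1 :=
      add_le_add (edist_nilpotentGraph_le_one hab) (edist_nilpotentGraph_le_one hbc)
    _ = 2 := one_add_one_eq_two

theorem ediam_nilpotentGraph_eq_two_of_not_isSemiprime (hS : ¬ IsSemiprime S) {y : S}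
    (hy : (fun k : ℕ => y ^ k).Injective) : (nilpotentGraph S).ediam = 2 := by
  obtain ⟨r, hr, hr0⟩ : ∃ r : S, (∀ s, r * s * r = 0) ∧ r ≠ 0 := by
    simpa only [IsSemiprime, not_forall, exists_prop] using hS
  have hnil (s : S) : IsNilpotent (r * s) := ⟨2, by rw [sq, ← mul_assoc, hr, zero_mul]⟩
  have vertex {a : S} (ha : a ≠ 0) : a ∈ nilZeroDivisors S :=
    ⟨ha, r, hr0, isNilpotent_mul_swap (hnil a)⟩
  refine le_antisymm (SimpleGraph.ediam_le_of_edist_le fun a b => ?_) ?_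
  · exact edist_nilpotentGraph_le_two (b := ⟨r, vertex hr0⟩) (isNilpotent_mul_swap (hnil a))
      (hnil b)
  have : Nontrivial S := ⟨r, 0, hr0⟩
  have hy_nil : ¬ IsNilpotent y := by
    rintro ⟨k, hk⟩
    exact k.succ_ne_self (hy (by simp only [pow_succ, hk, zero_mul]))
  by_contra! hlt
  have hy0 : y ≠ 0 := fun h => hy_nil (h ▸ .zero)
  rcases adj_or_eq_of_ediam_lt_two hlt ⟨1, vertex one_ne_zero⟩ ⟨y, vertex hy0⟩ with h | h
  · exact hy_nil (by simpa only [one_mul] using h.2)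
  · exact zero_ne_one (hy (by simpa only [pow_zero, pow_one, Subtype.mk.injEq] using h))

end NilpotentGraph

section ReducedNilpotentGraph

variable {S : Type*} [Ring S] [IsReduced S]

theorem mem_nilZeroDivisors_iff {a : S} :
    a ∈ nilZeroDivisors S ↔ a ≠ 0 ∧ ∃ b : S, b ≠ 0 ∧ a * b = 0 := by
  simp only [nilZeroDivisors, Set.mem_ofPred_eq, isNilpotent_iff_eq_zero]

theorem mul_eq_zero_or_swap_iff {a b : S} : a * b = 0 ∨ b * a = 0 ↔ a * b = 0 :=
  or_iff_left_of_imp mul_eq_zero_swap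

theorem nilZeroDivisors_eq_zeroDivisors : nilZeroDivisors S = zeroDivisors S := by
  ext a
  simp only [mem_nilZeroDivisors_iff, zeroDivisors, Set.mem_ofPred_eq, mul_eq_zero_or_swap_iff]

theorem ediam_nilpotentGraph_eq_ediam_zeroDivisorGraph :
    (nilpotentGraph S).ediam = (zeroDivisorGraph S).ediam :=
  ediam_congr nilZeroDivisors_eq_zeroDivisors fun a b _ _ => by
    simp only [nilpotentGraph, zeroDivisorGraph, isNilpotent_iff_eq_zero,
      mul_eq_zero_or_swap_iff, ne_eq, Subtype.mk.injEq]

theorem ediam_nilpotentGraph_le_three : (nilpotentGraph S).ediam ≤ 3 := by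
  refine SimpleGraph.ediam_le_of_edist_le ?_
  rintro ⟨a, ha⟩ ⟨b, hb⟩
  obtain ⟨ha0, c, hc0, hac⟩ := mem_nilZeroDivisors_iff.1 ha
  obtain ⟨hb0, d, hd0, hbd⟩ := mem_nilZeroDivisors_iff.1 hb
  have hdb := mul_eq_zero_swap hbd
  have hc : c ∈ nilZeroDivisors S :=
    mem_nilZeroDivisors_iff.2 ⟨hc0, a, ha0, mul_eq_zero_swap hac⟩
  have hd : d ∈ nilZeroDivisors S := mem_nilZeroDivisors_iff.2 ⟨hd0, b, hb0, hdb⟩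
  have nil {p : S} (hp : p = 0) : IsNilpotent p := isNilpotent_iff_eq_zero.2 hp
  by_cases hcd : c * d = 0
  · let G := nilpotentGraph S
    calc G.edist ⟨a, ha⟩ ⟨b, hb⟩
        ≤ G.edist ⟨a, ha⟩ ⟨d, hd⟩ + G.edist ⟨d, hd⟩ ⟨b, hb⟩ := SimpleGraph.edist_triangle
      _ ≤ 2 + 1 := add_le_add (edist_nilpotentGraph_le_two (b := ⟨c, hc⟩) (nil hac) (nil hcd))
          (edist_nilpotentGraph_le_one (nil hdb))
      _ = 3 := two_add_one_eq_three
  · have hacd : a * (c * d) = 0 := by rw [← mul_assoc, hac, zero_mul]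
    have hcdb : c * d * b = 0 := by rw [mul_assoc, hdb, mul_zero]
    have hmem : c * d ∈ nilZeroDivisors S := mem_nilZeroDivisors_iff.2 ⟨hcd, b, hb0, hcdb⟩
    calc (nilpotentGraph S).edist ⟨a, ha⟩ ⟨b, hb⟩
        ≤ 2 := edist_nilpotentGraph_le_two (b := ⟨c * d, hmem⟩) (nil hacd) (nil hcdb)
      _ ≤ 3 := by norm_num

theorem mul_eq_zero_or_eq_self_of_ediam_nilpotentGraph_lt_two
    (h : (nilpotentGraph S).ediam < 2) {a : S} (ha : a ∈ nilZeroDivisors S) (y : S) :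
    a * y = 0 ∨ a * y = a := by
  rw [or_iff_not_imp_left]
  intro hay
  obtain ⟨-, b, hb0, hab⟩ := mem_nilZeroDivisors_iff.1 ha
  have hay_mem : a * y ∈ nilZeroDivisors S :=
    mem_nilZeroDivisors_iff.2 ⟨hay, b, hb0, mul_mul_eq_zero_of_mul_eq_zero hab y⟩
  rcases adj_or_eq_of_ediam_lt_two h ⟨a, ha⟩ ⟨a * y, hay_mem⟩ with hadj | heq
  · have haay : a * (a * y) = 0 := isNilpotent_iff_eq_zero.1 hadj.2
    have hayay : a * y * (a * y) = 0 := mul_mul_eq_zero_of_mul_eq_zero haay y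
    exact absurd (eq_zero_of_mul_self_eq_zero hayay) hay
  · exact (congrArg Subtype.val heq).symm

theorem isIdempotentElem_of_ediam_nilpotentGraph_lt_two (h : (nilpotentGraph S).ediam < 2)
    (hne : (nilZeroDivisors S).Nonempty) (y : S) : IsIdempotentElem y := by
  obtain ⟨a, ha⟩ := hne
  obtain ⟨ha0, b, hb0, hab⟩ := mem_nilZeroDivisors_iff.1 ha
  have haa : IsIdempotentElem a :=
    (mul_eq_zero_or_eq_self_of_ediam_nilpotentGraph_lt_two h ha a).resolve_left
      (mt eq_zero_of_mul_self_eq_zero ha0)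
  have h1a0 : 1 - a ≠ 0 := fun h1 => hb0 (by rw [← one_mul b, sub_eq_zero.1 h1, hab])
  have h1a : 1 - a ∈ nilZeroDivisors S :=
    mem_nilZeroDivisors_iff.2 ⟨h1a0, a, ha0, haa.one_sub_mul_self⟩
  -- Both `a` and `1 - a` are vertices, so `y = a * y + (1 - a) * y` is `0`, `1 - a`, `a` or `1`.
  have hy : y = a * y + (1 - a) * y := by rw [← add_mul, add_sub_cancel, one_mul]
  rcases mul_eq_zero_or_eq_self_of_ediam_nilpotentGraph_lt_two h ha y with h₁ | h₁ <;>
    rcases mul_eq_zero_or_eq_self_of_ediam_nilpotentGraph_lt_two h h1a y with h₂ | h₂ <;>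
    rw [hy, h₁, h₂]
  · simpa only [add_zero] using IsIdempotentElem.zero
  · simpa only [zero_add] using haa.one_sub
  · simpa only [add_zero] using haa
  · simpa only [add_sub_cancel] using IsIdempotentElem.one

end ReducedNilpotentGraph

/-! ### Words and the degree filtration -/

section Words

variable {n : ℕ}

/-- The non-decreasing word in the indices of the variables with exponent vector `α`. -/
def stdWord (α : Fin n → ℕ) : List (Fin n) :=
  (List.ofFn fun i => List.replicate (α i) i).flatten

theorem count_stdWord (α : Fin n → ℕ) (i : Fin n) : (stdWord α).count i = α i := by
  rw [stdWord, List.count_flatten, List.map_ofFn, List.sum_ofFn]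
  simp [List.count_replicate]

theorem sum_count_eq_length (w : List (Fin n)) : ∑ i, w.count i = w.length := by
  simpa using Multiset.sum_count_eq_card (s := Finset.univ) (m := (w : Multiset (Fin n))) (by simp)

theorem length_stdWord (α : Fin n → ℕ) : (stdWord α).length = ∑ i, α i := by
  simp only [← sum_count_eq_length, count_stdWord]

theorem perm_stdWord_count (w : List (Fin n)) : w.Perm (stdWord fun i => w.count i) := by
  simp only [List.perm_iff_count, count_stdWord, implies_true]

theorem stdWord_single (i : Fin n) (k : ℕ) : stdWord (Pi.single i k) = List.replicate k i := by
  rw [← List.perm_replicate, List.perm_iff_count]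
  intro j
  obtain rfl | hij := eq_or_ne j i
  · simp [count_stdWord]
  · simp [count_stdWord, List.count_replicate, hij, hij.symm]

variable {A : Type*} [Ring A] {R : Subring A} {x : Fin n → A}

variable (x) in
theorem prod_map_stdWord (α : Fin n → ℕ) :
    ((stdWord α).map x).prod = stdMonomial x α := by
  simp [stdWord, stdMonomial, List.map_flatten, List.prod_flatten, List.map_ofFn,
    Function.comp_def]

variable (R x) in
/-- The left `R`-span of the products of fewer than `k` variables, in any order. For a skew PBW
extension these submodules form the filtration of `A` by total degree. -/
def wordSpan (k : ℕ) : Submodule R A :=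
  Submodule.span R {a | ∃ w : List (Fin n), w.length < k ∧ (w.map x).prod = a}

theorem prod_map_mem_wordSpan {w : List (Fin n)} {k : ℕ} (hw : w.length < k) :
    (w.map x).prod ∈ wordSpan R x k :=
  Submodule.subset_span ⟨w, hw, rfl⟩

theorem wordSpan_mono : Monotone (wordSpan R x) := fun _ _ hkl =>
  Submodule.span_mono fun _ ⟨w, hw, e⟩ => ⟨w, hw.trans_le hkl, e⟩

theorem mul_prod_map_mem_wordSpan {a : A} {k : ℕ} (ha : a ∈ wordSpan R x k) (w : List (Fin n)) :
    a * (w.map x).prod ∈ wordSpan R x (k + w.length) := by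
  induction ha using Submodule.span_induction with
  | mem a ha =>
    obtain ⟨v, hv, rfl⟩ := ha
    rw [← List.prod_append, ← List.map_append]
    exact prod_map_mem_wordSpan (by simpa using hv)
  | zero => simp
  | add a b _ _ iha ihb => rw [add_mul]; exact add_mem iha ihb
  | smul r a _ ih => rw [smul_mul_assoc]; exact Submodule.smul_mem _ _ ih

theorem smodEq_mul_prod_map {a b : A} {k : ℕ} (hab : a ≡ b [SMOD wordSpan R x k])
    (w : List (Fin n)) :
    a * (w.map x).prod ≡ b * (w.map x).prod [SMOD wordSpan R x (k + w.length)] := by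
  rw [SModEq.sub_mem] at hab ⊢
  rw [← sub_mul]
  exact mul_prod_map_mem_wordSpan hab w

end Words

namespace IsSkewPBWExtension

variable {A : Type*} [Ring A] {R : Subring A} {n : ℕ} {x : Fin n → A}

theorem basis_apply (h : IsSkewPBWExtension R x) (α : Fin n → ℕ) :
    h.basis α = stdMonomial x α :=
  Module.Basis.mk_apply _ _ α

theorem mul_smul_eq (h : IsSkewPBWExtension R x) (i : Fin n) (r : R) (a : A) :
    x i * (r • a) = h.sigma i r • (x i * a) + h.delta i r • a := by
  simp only [Subring.smul_def, smul_eq_mul, ← mul_assoc, h.mul_eq_sigma_delta, add_mul]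

theorem mul_mem_wordSpan (h : IsSkewPBWExtension R x) (i : Fin n) {a : A} {k : ℕ}
    (ha : a ∈ wordSpan R x k) : x i * a ∈ wordSpan R x (k + 1) := by
  induction ha using Submodule.span_induction with
  | mem a ha =>
    obtain ⟨v, hv, rfl⟩ := ha
    rw [← List.prod_cons, ← List.map_cons]
    exact prod_map_mem_wordSpan (by simpa using hv)
  | zero => simp
  | add a b _ _ iha ihb => rw [mul_add]; exact add_mem iha ihb
  | smul r a ha ih =>
    rw [h.mul_smul_eq]
    exact add_mem (Submodule.smul_mem _ _ ih)
      (Submodule.smul_mem _ _ (wordSpan_mono k.le_succ ha))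

theorem mul_smodEq_sigma_smul (h : IsSkewPBWExtension R x) (i : Fin n) {a b : A} {d : R} {k : ℕ}
    (hab : a ≡ d • b [SMOD wordSpan R x k]) (hb : b ∈ wordSpan R x (k + 1)) :
    x i * a ≡ h.sigma i d • (x i * b) [SMOD wordSpan R x (k + 1)] := by
  rw [SModEq.sub_mem] at hab ⊢
  have split : x i * a - h.sigma i d • (x i * b) = x i * (a - d • b) + h.delta i d • b := by
    rw [mul_sub, h.mul_smul_eq]
    abel
  rw [split]
  exact add_mem (h.mul_mem_wordSpan i hab) (Submodule.smul_mem _ _ hb)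

theorem exists_smodEq_smul_swap (h : IsSkewPBWExtension R x) (i j : Fin n) :
    ∃ d : R, x j * x i ≡ d • (x i * x j) [SMOD wordSpan R x 2] := by
  obtain ⟨d, -, r₀, r, hd⟩ := h.exists_comm i j
  have one_mem : (1 : A) ∈ wordSpan R x 2 := prod_map_mem_wordSpan (w := []) (by simp)
  have var_mem (k : Fin n) : x k ∈ wordSpan R x 2 := by
    simpa using prod_map_mem_wordSpan (R := R) (x := x) (w := [k]) one_lt_two
  refine ⟨d, SModEq.sub_mem.2 ?_⟩
  rw [Subring.smul_def, smul_eq_mul, hd, ← mul_one (r₀ : A)]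
  exact add_mem (Submodule.smul_mem _ r₀ one_mem)
    (sum_mem fun k _ => Submodule.smul_mem _ (r k) (var_mem k))

theorem exists_smodEq_smul_of_perm (h : IsSkewPBWExtension R x) {v w : List (Fin n)}
    (hvw : v.Perm w) :
    ∃ d : R, (v.map x).prod ≡ d • (w.map x).prod [SMOD wordSpan R x v.length] := by
  induction hvw with
  | nil => exact ⟨1, by rw [one_smul]⟩
  | @cons i v w hvw ih =>
    obtain ⟨d, hd⟩ := ih
    have hw : (w.map x).prod ∈ wordSpan R x (v.length + 1) :=
      prod_map_mem_wordSpan (by simp [hvw.length_eq])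
    exact ⟨h.sigma i d, by simpa using h.mul_smodEq_sigma_smul i hd hw⟩
  | swap i j w =>
    obtain ⟨d, hd⟩ := h.exists_smodEq_smul_swap i j
    have hdw := smodEq_mul_prod_map hd w
    rw [smul_mul_assoc, add_comm 2] at hdw
    exact ⟨d, by simpa [mul_assoc] using hdw⟩
  | @trans u v w huv _ ih₁ ih₂ =>
    obtain ⟨d, hd⟩ := ih₁
    obtain ⟨e, he⟩ := ih₂
    rw [← huv.length_eq] at he
    exact ⟨d * e, by simpa only [mul_smul] using hd.trans (he.smul d)⟩

theorem repr_smul_stdMonomial (h : IsSkewPBWExtension R x) (r : R) (α : Fin n → ℕ) :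
    h.basis.repr (r • stdMonomial x α) = Finsupp.single α r := by
  rw [← h.basis_apply, map_smul, Module.Basis.repr_self, Finsupp.smul_single_one]

theorem repr_apply_eq_zero_of_mem_wordSpan (h : IsSkewPBWExtension R x) {k : ℕ} {a : A}
    (ha : a ∈ wordSpan R x k) {α : Fin n → ℕ} (hα : k ≤ ∑ i, α i) : h.basis.repr a α = 0 := by
  induction k using Nat.strong_induction_on generalizing a with
  | _ k ihk =>
  induction ha using Submodule.span_induction with
  | mem a ha =>
    obtain ⟨w, hw, rfl⟩ := ha
    obtain ⟨d, hd⟩ := h.exists_smodEq_smul_of_perm (perm_stdWord_count w)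
    have hne : α ≠ fun i => w.count i := by
      rintro rfl
      rw [sum_count_eq_length] at hα
      exact hw.not_ge hα
    have h0 := ihk _ hw (SModEq.sub_mem.1 hd) (hw.le.trans hα)
    rwa [prod_map_stdWord, map_sub, repr_smul_stdMonomial, Finsupp.sub_apply,
      Finsupp.single_eq_of_ne hne, sub_zero] at h0
  | zero => simp
  | add a b _ _ iha ihb => simp [iha, ihb]
  | smul r a _ ih => simp [ih]

theorem repr_apply_eq_of_smodEq (h : IsSkewPBWExtension R x) {k : ℕ} {a b : A}
    (hab : a ≡ b [SMOD wordSpan R x k]) {α : Fin n → ℕ} (hα : k ≤ ∑ i, α i) :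
    h.basis.repr a α = h.basis.repr b α := by
  rw [← sub_eq_zero, ← Finsupp.sub_apply, ← map_sub]
  exact h.repr_apply_eq_zero_of_mem_wordSpan (SModEq.sub_mem.1 hab) hα

theorem exists_isUnit_smodEq_stdMonomial (h : IsSkewPBWExtension R x) [IsDedekindFiniteMonoid R]
    {w : List (Fin n)} {α : Fin n → ℕ} (hα : ∀ i, w.count i = α i) :
    ∃ d : R, IsUnit d ∧ (w.map x).prod ≡ d • stdMonomial x α [SMOD wordSpan R x w.length] := by
  have hw : w.Perm (stdWord α) := by simpa only [List.perm_iff_count, count_stdWord] using hα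
  obtain ⟨d, hd⟩ := h.exists_smodEq_smul_of_perm hw
  obtain ⟨e, he⟩ := h.exists_smodEq_smul_of_perm hw.symm
  rw [prod_map_stdWord] at hd he
  rw [← hw.length_eq] at he
  -- Rearranging `stdMonomial x α` to `w` and back multiplies its leading coefficient by `e * d`.
  have hed : stdMonomial x α ≡ (e * d) • stdMonomial x α [SMOD wordSpan R x w.length] := by
    rw [mul_smul]
    exact he.trans (hd.smul e)
  have hlen : w.length ≤ ∑ i, α i := (hw.length_eq.trans (length_stdWord α)).le
  have h1 := h.repr_apply_eq_of_smodEq hed hlen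
  rw [← one_smul R (stdMonomial x α), ← mul_smul, mul_one, repr_smul_stdMonomial,
    repr_smul_stdMonomial, Finsupp.single_eq_same, Finsupp.single_eq_same] at h1
  exact ⟨d, IsUnit.of_mul_eq_one_right e h1.symm, hd⟩

theorem exists_prod_map_mul_smodEq (h : IsSkewPBWExtension R x)
    (hσ : ∀ (i : Fin n) (a b : R), a * h.sigma i b = 0 → a * b = 0) (w : List (Fin n)) (r : R) :
    ∃ s : R, (∀ a, a * s = 0 → a * r = 0) ∧
      (w.map x).prod * r ≡ s • (w.map x).prod [SMOD wordSpan R x w.length] := by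
  induction w with
  | nil => exact ⟨r, fun _ => id, by simp [Subring.smul_def]⟩
  | cons i w ih =>
    obtain ⟨s, hs, hmod⟩ := ih
    refine ⟨h.sigma i s, fun a ha => hs a (hσ i a s ha), ?_⟩
    simpa [mul_assoc] using
      h.mul_smodEq_sigma_smul i hmod (prod_map_mem_wordSpan w.length.lt_succ_self)

theorem exists_repr_stdMonomial_mul (h : IsSkewPBWExtension R x) [IsDedekindFiniteMonoid R]
    (hσ : ∀ (i : Fin n) (a b : R), a * h.sigma i b = 0 → a * b = 0) (α β : Fin n → ℕ) (r : R) :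
    ∃ s : R, (∀ a, a * s = 0 → a * r = 0) ∧ ∀ γ : Fin n → ℕ, ∑ i, α i + ∑ i, β i ≤ ∑ i, γ i →
      h.basis.repr (stdMonomial x α * r • stdMonomial x β) γ = Finsupp.single (α + β) s γ := by
  obtain ⟨s, hs, hmod⟩ := h.exists_prod_map_mul_smodEq hσ (stdWord α) r
  obtain ⟨d, hd, hperm⟩ := h.exists_isUnit_smodEq_stdMonomial (w := stdWord α ++ stdWord β)
    (α := α + β) (by simp [count_stdWord])
  refine ⟨s * d, fun a ha => hs a ?_, fun γ hγ => ?_⟩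
  · rwa [← mul_assoc, hd.mul_left_eq_zero] at ha
  have hmod' := smodEq_mul_prod_map hmod (stdWord β)
  rw [List.length_append] at hperm
  have hprod : stdMonomial x α * r • stdMonomial x β ≡ (s * d) • stdMonomial x (α + β)
      [SMOD wordSpan R x ((stdWord α).length + (stdWord β).length)] := by
    rw [mul_smul]
    refine .trans ?_ (hperm.smul s)
    simpa [prod_map_stdWord, Subring.smul_def, mul_assoc] using hmod'
  rw [h.repr_apply_eq_of_smodEq hprod (by simpa only [length_stdWord] using hγ),
    repr_smul_stdMonomial]

end IsSkewPBWExtension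

/-! ### Leading terms -/

section DegLex

variable {n : ℕ}

/-- The exponent vector `α` placed in the degree-lexicographic order: first the total degree is
compared, then the exponents lexicographically. Leading coefficients refer to this order. -/
def degLex (α : Fin n → ℕ) : ℕ ×ₗ Lex (Fin n → ℕ) :=
  toLex (∑ i, α i, toLex α)

theorem degLex_injective : Function.Injective (degLex (n := n)) := fun _ _ h =>
  toLex.injective (congrArg (fun p => (ofLex p).2) h)

theorem degLex_add (α β : Fin n → ℕ) : degLex (α + β) = degLex α + degLex β := by
  simp [degLex, Finset.sum_add_distrib, ← toLex_add]

theorem sum_le_sum_of_degLex_le {α β : Fin n → ℕ} (h : degLex α ≤ degLex β) :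
    ∑ i, α i ≤ ∑ i, β i :=
  Prod.Lex.monotone_fst _ _ h

theorem add_eq_add_iff_of_degLex_le {α β γ ε : Fin n → ℕ} (hα : degLex α ≤ degLex γ)
    (hβ : degLex β ≤ degLex ε) : α + β = γ + ε ↔ α = γ ∧ β = ε := by
  simp only [← degLex_injective.eq_iff (a := α + β), degLex_add,
    add_eq_add_iff_eq_and_eq hα hβ, degLex_injective.eq_iff]

end DegLex

namespace IsSkewPBWExtension

variable {A : Type*} [Ring A] {R : Subring A} {n : ℕ} {x : Fin n → A}

theorem sum_repr_smul_stdMonomial (h : IsSkewPBWExtension R x) (f : A) :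
    ∑ α ∈ (h.basis.repr f).support, h.basis.repr f α • stdMonomial x α = f := by
  conv_rhs => rw [← h.basis.linearCombination_repr f]
  simp only [Finsupp.linearCombination_apply, Finsupp.sum, h.basis_apply]

theorem repr_mul_apply (h : IsSkewPBWExtension R x) (f g : A) (γ : Fin n → ℕ) :
    h.basis.repr (f * g) γ =
      ∑ α ∈ (h.basis.repr f).support, ∑ β ∈ (h.basis.repr g).support,
        h.basis.repr f α *
          h.basis.repr (stdMonomial x α * h.basis.repr g β • stdMonomial x β) γ := by
  conv_lhs => rw [← h.sum_repr_smul_stdMonomial f, ← h.sum_repr_smul_stdMonomial g]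
  simp only [Finset.sum_mul_sum, map_sum, Finsupp.finsetSum_apply, smul_mul_assoc, map_smul,
    Finsupp.smul_apply, smul_eq_mul]

/-- `γ` is the exponent of the degree-lexicographically leading term of `f`. -/
def IsLeadingExponent (h : IsSkewPBWExtension R x) (f : A) (γ : Fin n → ℕ) : Prop :=
  γ ∈ (h.basis.repr f).support ∧ ∀ α ∈ (h.basis.repr f).support, degLex α ≤ degLex γ

theorem exists_isLeadingExponent (h : IsSkewPBWExtension R x) {f : A} (hf : f ≠ 0) :
    ∃ γ, h.IsLeadingExponent f γ := by
  have hne : (h.basis.repr f).support.Nonempty := by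
    rwa [Finsupp.support_nonempty_iff, ne_eq, LinearEquiv.map_eq_zero_iff]
  exact Finset.exists_max_image _ degLex hne

theorem exists_repr_mul_apply_add_eq (h : IsSkewPBWExtension R x) [IsDedekindFiniteMonoid R]
    (hσ : ∀ (i : Fin n) (a b : R), a * h.sigma i b = 0 → a * b = 0) {f g : A}
    {γ ε : Fin n → ℕ} (hγ : h.IsLeadingExponent f γ) (hε : h.IsLeadingExponent g ε) :
    ∃ s : R, (∀ a, a * s = 0 → a * h.basis.repr g ε = 0) ∧
      h.basis.repr (f * g) (γ + ε) = h.basis.repr f γ * s := by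
  choose s hs hcoeff using fun α β => h.exists_repr_stdMonomial_mul hσ α β (h.basis.repr g β)
  refine ⟨s γ ε, hs γ ε, ?_⟩
  have hterm {α β : Fin n → ℕ} (hα : degLex α ≤ degLex γ) (hβ : degLex β ≤ degLex ε) :
      h.basis.repr (stdMonomial x α * h.basis.repr g β • stdMonomial x β) (γ + ε) =
        if α = γ ∧ β = ε then s α β else 0 := by
    have hdeg : ∑ i, α i + ∑ i, β i ≤ ∑ i, (γ + ε) i := by
      simpa only [Pi.add_apply, Finset.sum_add_distrib] using
        add_le_add (sum_le_sum_of_degLex_le hα) (sum_le_sum_of_degLex_le hβ)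
    rw [hcoeff α β _ hdeg, Finsupp.single_apply]
    simp only [add_eq_add_iff_of_degLex_le hα hβ]
  rw [h.repr_mul_apply, Finset.sum_eq_single_of_mem γ hγ.1, Finset.sum_eq_single_of_mem ε hε.1,
    hterm le_rfl le_rfl, if_pos ⟨rfl, rfl⟩]
  · intro β hβ hne
    rw [hterm le_rfl (hε.2 β hβ), if_neg (hne ·.2), mul_zero]
  · intro α hα hne
    refine Finset.sum_eq_zero fun β hβ => ?_
    rw [hterm (hγ.2 α hα) (hε.2 β hβ), if_neg (hne ·.1), mul_zero]

theorem isReduced (h : IsSkewPBWExtension R x) [IsReduced R]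
    (hσ : ∀ (i : Fin n) (a b : R), a * h.sigma i b = 0 → a * b = 0) : IsReduced A := by
  refine isReduced_of_mul_self_eq_zero fun f hff => ?_
  by_contra hf
  obtain ⟨γ, hγ⟩ := h.exists_isLeadingExponent hf
  obtain ⟨s, hs, hcoeff⟩ := h.exists_repr_mul_apply_add_eq hσ hγ hγ
  rw [hff, map_zero, Finsupp.zero_apply] at hcoeff
  exact Finsupp.mem_support_iff.1 hγ.1 (eq_zero_of_mul_self_eq_zero (hs _ hcoeff.symm))

end IsSkewPBWExtension

/-! ### Compatible extensions -/

section IterComp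

variable {T : Type*}

theorem iterComp_succ {n : ℕ} (f : Fin (n + 1) → T → T) (α : Fin (n + 1) → ℕ) :
    iterComp f α = (f 0)^[α 0] ∘ iterComp (fun k => f k.succ) (fun k => α k.succ) := by
  rw [iterComp, List.ofFn_succ, List.foldr_cons, iterComp]

theorem iterComp_zero {n : ℕ} (f : Fin n → T → T) : iterComp f 0 = id := by
  induction n with
  | zero => rfl
  | succ n ih => exact (iterComp_succ f 0).trans (ih _)

theorem iterComp_single {n : ℕ} (f : Fin n → T → T) (i : Fin n) :
    iterComp f (Pi.single i 1) = f i := by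
  induction n with
  | zero => exact i.elim0
  | succ n ih =>
    rw [iterComp_succ]
    induction i using Fin.cases with
    | zero =>
      have htail : (fun k : Fin n => (Pi.single 0 1 : Fin (n + 1) → ℕ) k.succ) = 0 := by
        ext k
        simp
      rw [htail, iterComp_zero]
      simp
    | succ j =>
      have htail : (fun k : Fin n => (Pi.single j.succ 1 : Fin (n + 1) → ℕ) k.succ)
          = Pi.single j 1 := by
        ext k
        simp [Pi.single_apply]
      rw [htail, ih]
      simp

end IterComp

namespace IsSkewPBWExtension

variable {A : Type*} [Ring A] {R : Subring A} {n : ℕ} {x : Fin n → A}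

theorem mul_sigma_eq_zero_iff (h : IsSkewPBWExtension R x)
    (hcompat : IsCompatible h.sigma h.delta) (i : Fin n) (a b : R) :
    a * h.sigma i b = 0 ↔ a * b = 0 := by
  rw [← hcompat.1 a b (Pi.single i 1), iterComp_single]

theorem mul_delta_eq_zero (h : IsSkewPBWExtension R x)
    (hcompat : IsCompatible h.sigma h.delta) (i : Fin n) {a b : R} (hab : a * b = 0) :
    a * h.delta i b = 0 := by
  rw [← iterComp_single h.delta i]
  exact hcompat.2 a b _ hab

theorem coe_mul_prod_map_mul_coe_eq_zero (h : IsSkewPBWExtension R x)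
    (hcompat : IsCompatible h.sigma h.delta) (w : List (Fin n)) {a b : R} (hab : a * b = 0) :
    (a : A) * (w.map x).prod * b = 0 := by
  induction w using List.reverseRecOn generalizing b with
  | nil => simpa using congrArg Subtype.val hab
  | append_singleton w i ih =>
    have hσ := ih ((h.mul_sigma_eq_zero_iff hcompat i a b).2 hab)
    have hδ := ih (h.mul_delta_eq_zero hcompat i hab)
    calc (a : A) * ((w ++ [i]).map x).prod * b = a * (w.map x).prod * (x i * b) := by
          simp [mul_assoc]
      _ = a * (w.map x).prod * h.sigma i b * x i + a * (w.map x).prod * h.delta i b := by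
          rw [h.mul_eq_sigma_delta, mul_add, ← mul_assoc]
      _ = 0 := by rw [hσ, hδ, zero_mul, add_zero]

theorem coe_mul_mul_coe_eq_zero (h : IsSkewPBWExtension R x)
    (hcompat : IsCompatible h.sigma h.delta) {a b : R} (hab : ∀ s, a * s * b = 0) (f : A) :
    (a : A) * f * b = 0 := by
  rw [← h.sum_repr_smul_stdMonomial f, Finset.mul_sum, Finset.sum_mul]
  refine Finset.sum_eq_zero fun α _ => ?_
  rw [← prod_map_stdWord, Subring.smul_def, smul_eq_mul, ← mul_assoc, ← Subring.coe_mul]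
  exact h.coe_mul_prod_map_mul_coe_eq_zero hcompat _ (hab _)

theorem isSemiprime_subring (h : IsSkewPBWExtension R x)
    (hcompat : IsCompatible h.sigma h.delta) (hA : IsSemiprime A) : IsSemiprime R :=
  fun r hr => Subtype.ext (hA r (h.coe_mul_mul_coe_eq_zero hcompat hr))

theorem pow_injective (h : IsSkewPBWExtension R x) [Nontrivial A] (i : Fin n) :
    (fun k : ℕ => x i ^ k).Injective := by
  have pow_eq (k : ℕ) : x i ^ k = stdMonomial x (Pi.single i k) := by
    rw [← prod_map_stdWord, stdWord_single, List.map_replicate, List.prod_replicate]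
  intro k l hkl
  simp only [pow_eq] at hkl
  exact Pi.single_injective i (h.linearIndependent.injective hkl)

end IsSkewPBWExtension

end NilpotentGraphPaper

open NilpotentGraphPaper in
theorem mainTheorem2_general {A : Type*} [Ring A] (R : Subring A) {n : ℕ} (hn : 1 ≤ n)
    (x : Fin n → A) (hA : IsSkewPBWExtension R x)
    (hcompat : IsCompatible hA.sigma hA.delta) (hR : IsSemiprime R → IsReduced R) :
    ((nilZeroDivisors A).Nonempty → 2 ≤ (nilpotentGraph A).ediam) ∧
    (nilpotentGraph A).ediam ≤ 3 ∧
    (¬ IsReduced R → (nilpotentGraph A).ediam = 2) ∧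
    (IsReduced R → (nilpotentGraph A).ediam = (zeroDivisorGraph A).ediam ∧
      (zeroDivisorGraph A).ediam ≤ 3) := by
  let i : Fin n := ⟨0, hn⟩
  by_cases hred : IsReduced R
  · have : IsReduced A := hA.isReduced fun i a b => (hA.mul_sigma_eq_zero_iff hcompat i a b).1
    have heq := ediam_nilpotentGraph_eq_ediam_zeroDivisorGraph (S := A)
    have hle := ediam_nilpotentGraph_le_three (S := A)
    refine ⟨fun hne => ?_, hle, absurd hred, fun _ => ⟨heq, heq ▸ hle⟩⟩
    by_contra! hlt
    have : Nontrivial A := ⟨hne.some, 0, hne.some_mem.1⟩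
    have hidem := isIdempotentElem_of_ediam_nilpotentGraph_lt_two hlt hne (x i)
    have hpow : x i ^ 2 = x i ^ 1 := by rw [sq, pow_one, hidem.eq]
    exact absurd (hA.pow_injective i hpow) (by norm_num)
  · have hsemi : ¬ IsSemiprime A := fun hA' =>
      hred (hR (hA.isSemiprime_subring hcompat hA'))
    have : Nontrivial A := by
      by_contra! htriv
      exact hsemi fun a _ => Subsingleton.elim a 0
    have h2 : (nilpotentGraph A).ediam = 2 :=
      ediam_nilpotentGraph_eq_two_of_not_isSemiprime hsemi (hA.pow_injective i)
    exact ⟨fun _ => h2.ge, h2.le.trans (by norm_num), fun _ => h2, fun h => absurd h hred⟩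

open NilpotentGraphPaper in
theorem mainTheorem2 {A : Type*} [Ring A] (R : Subring A) {n : ℕ} (hn : 1 ≤ n)
    (x : Fin n → A) (hA : IsSkewPBWExtension R x)
    (hcompat : IsCompatible hA.sigma hA.delta) (hprimal : IsTwoPrimal R) :
    ((nilZeroDivisors A).Nonempty → 2 ≤ (nilpotentGraph A).ediam) ∧
    (nilpotentGraph A).ediam ≤ 3 ∧
    (¬ IsReduced R → (nilpotentGraph A).ediam = 2) ∧
    (IsReduced R → (nilpotentGraph A).ediam = (zeroDivisorGraph A).ediam ∧
      (zeroDivisorGraph A).ediam ≤ 3) :=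
  mainTheorem2_general R hn x hA hcompat hprimal.isReduced_of_isSemiprime
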